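/- Let $\mathbb{R}^-=(-\infty,0]$ and let $w\in C^1(\mathbb{R}^-;\mathbb{R})$ satisfy $w>0$, $w'/w$ bounded and $w(0)=1$. Put $L^2_w=L^2(\mathbb{R}^-,w(\xi)\,d\xi;\mathbb{R})$ and let $H_w=\mathbb{R}\times L^2_w$ be the product Hilbert space, with elements $\mathbf{x}=(x_0,x_1)$. A function $f\in L^2_{loc}(\mathbb{R}^-)$ has weak derivative $f'=g\in L^2_{loc}(\mathbb{R}^-)$ if $\int_{\mathbb{R}^-} f\varphi'\,d\xi=-\int_{\mathbb{R}^-} g\varphi\,d\xi$ for all $\varphi\in C^1_c((-\infty,0);\mathbb{R})$; such an $f$ has a locally absolutely continuous version on $\mathbb{R}^-$, and $f(0)$ denotes the value at $0$ of that version. Let $W^{1,2}_w$ be the space of such $f$ with $\int_{\mathbb{R}^-}(|f|^2+|f'|^2)\,w\,d\xi<\infty$. Let $\mathcal{A}$ be the unbounded operator on $H_w$ given by $$D(\mathcal{A})=\{\mathbf{x}\in H_w : x_1\in W^{1,2}_w,\ x_0=x_1(0)\},\qquad \mathcal{A}\mathbf{x}=(0,x_1').$$ Then $\mathcal{A}$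 is densely defined, and its adjoint $\mathcal{A}^*$ in $H_w$ has domain $$D(\mathcal{A}^*)=\{\mathbf{x}\in H_w : x_1\in W^{1,2}_w\}$$ and acts by $$\mathcal{A}^*\mathbf{x}=\Big(x_1(0),\ -x_1'-x_1\frac{w'}{w}\Big).$$ -/

import Mathlib

open MeasureTheory Set

noncomputable section

namespace WeightedDelay

/-- A weight on `ℝ⁻ = (-∞, 0]`: a strictly positive `C¹` function `w` with `w' / w` bounded,
normalised by `w 0 = 1`.  Only the values on `(-∞, 0]` matter. -/
structure Weight where
  toFun : ℝ → ℝ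
  contDiffOn : ContDiffOn ℝ 1 toFun (Iic 0)
  pos : ∀ ξ ≤ 0, 0 < toFun ξ
  bounded : ∃ K : ℝ, ∀ ξ ≤ 0, |derivWithin toFun (Iic 0) ξ / toFun ξ| ≤ K
  map_zero : toFun 0 = 1

namespace Weight

instance : CoeFun Weight (fun _ => ℝ → ℝ) := ⟨Weight.toFun⟩

/-- The derivative `w'` on `(-∞, 0]` (one-sided at `0`). -/
def deriv (w : Weight) (ξ : ℝ) : ℝ := derivWithin w (Iic 0) ξ

/-- The measure `w(ξ) dξ` on `(-∞, 0]`. -/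
def measure (w : Weight) : Measure ℝ :=
  (volume.restrict (Iic (0 : ℝ))).withDensity (fun ξ => ENNReal.ofReal (w ξ))

theorem measure_absolutelyContinuous (w : Weight) :
    w.measure ≪ volume.restrict (Iic (0 : ℝ)) :=
  withDensity_absolutelyContinuous _ _

theorem absolutelyContinuous_measure (w : Weight) :
    volume.restrict (Iic (0 : ℝ)) ≪ w.measure := by
  refine withDensity_absolutelyContinuous' ?_ ?_
  · exact (w.contDiffOn.continuousOn.aemeasurable measurableSet_Iic).ennreal_ofReal
  · filter_upwards [ae_restrict_mem measurableSet_Iic] with ξ hξ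
    simpa using w.pos ξ hξ

end Weight

/-- `L²_w = L²(ℝ⁻, w(ξ) dξ; ℝ)`. -/
abbrev L2w (w : Weight) : Type := Lp ℝ 2 w.measure

/-- `H_w = ℝ × L²_w` with the Hilbert product structure. -/
abbrev Hw (w : Weight) : Type := WithLp 2 (ℝ × L2w w)

/-- `f ∈ L²_loc(ℝ⁻)`: square integrability on every compact interval `[a, 0]`. -/
def MemL2loc (f : ℝ → ℝ) : Prop :=
  ∀ a : ℝ, MemLp f 2 (volume.restrict (Icc a 0))

/-- `f ∈ L²_loc(ℝ⁻)` admits `g ∈ L²_loc(ℝ⁻)` as weak derivative, tested against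
`C¹_c((-∞, 0))`. -/
structure HasWeakDeriv (f g : ℝ → ℝ) : Prop where
  left_mem : MemL2loc f
  right_mem : MemL2loc g
  integral_eq : ∀ φ : ℝ → ℝ, ContDiff ℝ 1 φ → HasCompactSupport φ → tsupport φ ⊆ Iio 0 →
    ∫ ξ in Iic (0 : ℝ), f ξ * _root_.deriv φ ξ = - ∫ ξ in Iic (0 : ℝ), g ξ * φ ξ

theorem MemL2loc.add {f g : ℝ → ℝ} (hf : MemL2loc f) (hg : MemL2loc g) :
    MemL2loc (f + g) := fun a => (hf a).add (hg a)

theorem MemL2loc.const_smul {f : ℝ → ℝ} (c : ℝ) (hf : MemL2loc f) :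
    MemL2loc (c • f) := fun a => (hf a).const_smul c

theorem MemL2loc.congr {f g : ℝ → ℝ} (hf : MemL2loc f)
    (h : f =ᵐ[volume.restrict (Iic (0 : ℝ))] g) : MemL2loc g := fun a =>
  (memLp_congr_ae (ae_restrict_of_ae_restrict_of_subset Icc_subset_Iic_self h)).1 (hf a)

theorem MemL2loc.integrableOn {f : ℝ → ℝ} (hf : MemL2loc f) (a : ℝ) :
    IntegrableOn f (Icc a 0) := (hf a).integrable (by norm_num)

theorem MemL2loc.integrable_mul {f φ : ℝ → ℝ} (hf : MemL2loc f) (hφ : Continuous φ)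
    (hc : HasCompactSupport φ) :
    IntegrableOn (fun ξ => f ξ * φ ξ) (Iic 0) := by
  obtain ⟨a, ha⟩ := hc.isCompact.bddBelow
  have h1 : IntegrableOn (fun ξ => f ξ * φ ξ) (Icc a 0) :=
    (hf.integrableOn a).mul_continuousOn hφ.continuousOn isCompact_Icc
  refine h1.of_forall_sdiff_eq_zero measurableSet_Iic ?_
  intro x hx
  have : φ x = 0 := by
    by_contra h
    exact hx.2 ⟨ha (subset_tsupport _ h), hx.1⟩
  simp [this]

theorem HasWeakDeriv.congr {f g f' g' : ℝ → ℝ} (h : HasWeakDeriv f g)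
    (hf : f =ᵐ[volume.restrict (Iic (0 : ℝ))] f') (hg : g =ᵐ[volume.restrict (Iic (0 : ℝ))] g') :
    HasWeakDeriv f' g' where
  left_mem := h.left_mem.congr hf
  right_mem := h.right_mem.congr hg
  integral_eq φ h1 h2 h3 := by
    have e1 : ∫ ξ in Iic (0 : ℝ), f' ξ * _root_.deriv φ ξ
        = ∫ ξ in Iic (0 : ℝ), f ξ * _root_.deriv φ ξ :=
      integral_congr_ae (hf.mono fun x hx => by simp [hx])
    have e2 : ∫ ξ in Iic (0 : ℝ), g' ξ * φ ξ = ∫ ξ in Iic (0 : ℝ), g ξ * φ ξ :=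
      integral_congr_ae (hg.mono fun x hx => by simp [hx])
    rw [e1, e2, h.integral_eq φ h1 h2 h3]

theorem HasWeakDeriv.zero : HasWeakDeriv (0 : ℝ → ℝ) (0 : ℝ → ℝ) where
  left_mem _ := MemLp.zero
  right_mem _ := MemLp.zero
  integral_eq φ _ _ _ := by simp

theorem HasWeakDeriv.add {f g f' g' : ℝ → ℝ} (h : HasWeakDeriv f g) (h' : HasWeakDeriv f' g') :
    HasWeakDeriv (f + f') (g + g') where
  left_mem := h.left_mem.add h'.left_mem
  right_mem := h.right_mem.add h'.right_mem
  integral_eq φ h1 h2 h3 := by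
    have hd : Continuous (_root_.deriv φ) := h1.continuous_deriv le_rfl
    simp only [Pi.add_apply, add_mul]
    rw [integral_add (h.left_mem.integrable_mul hd h2.deriv)
        (h'.left_mem.integrable_mul hd h2.deriv),
      integral_add (h.right_mem.integrable_mul h1.continuous h2)
        (h'.right_mem.integrable_mul h1.continuous h2),
      h.integral_eq φ h1 h2 h3, h'.integral_eq φ h1 h2 h3]
    ring

theorem HasWeakDeriv.const_smul {f g : ℝ → ℝ} (c : ℝ) (h : HasWeakDeriv f g) :
    HasWeakDeriv (c • f) (c • g) where
  left_mem := h.left_mem.const_smul c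
  right_mem := h.right_mem.const_smul c
  integral_eq φ h1 h2 h3 := by
    simp only [Pi.smul_apply, smul_eq_mul, mul_assoc]
    rw [integral_const_mul, integral_const_mul, h.integral_eq φ h1 h2 h3]
    ring

theorem HasWeakDeriv.unique {f g g' : ℝ → ℝ} (h : HasWeakDeriv f g) (h' : HasWeakDeriv f g') :
    g =ᵐ[volume.restrict (Iic (0 : ℝ))] g' := by
  have hloc : ∀ k : ℝ → ℝ, MemL2loc k → LocallyIntegrableOn k (Iio 0) := by
    intro k hk x hx
    refine ⟨Icc (x - 1) 0 ∩ Iio 0, ?_, (hk.integrableOn _).mono_set inter_subset_left⟩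
    refine Filter.inter_mem (mem_nhdsWithin_of_mem_nhds (Icc_mem_nhds (by linarith) hx))
      self_mem_nhdsWithin
  have key := IsOpen.ae_eq_zero_of_integral_contDiff_smul_eq_zero (μ := volume)
    (f := fun ξ => g ξ - g' ξ) (isOpen_Iio (a := (0 : ℝ)))
    ((hloc g h.right_mem).sub (hloc g' h'.right_mem)) (by
      intro φ h1 h2 h3
      have h1' : ContDiff ℝ 1 φ := h1.of_le (by exact_mod_cast le_top)
      have e : ∫ x, φ x • (g x - g' x) = ∫ x in Iic (0 : ℝ), (g x * φ x - g' x * φ x) := by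
        rw [← setIntegral_eq_integral_of_forall_compl_eq_zero (s := Iic (0 : ℝ))]
        · congr 1; ext x; simp only [smul_eq_mul]; ring
        · intro x hx
          have : φ x = 0 := by
            by_contra hne
            exact hx (mem_Iic.2 (le_of_lt (h3 (subset_tsupport _ hne))))
          simp [this]
      rw [e, integral_sub (h.right_mem.integrable_mul h1'.continuous h2)
        (h'.right_mem.integrable_mul h1'.continuous h2)]
      have a1 := h.integral_eq φ h1' h2 h3
      have a2 := h'.integral_eq φ h1' h2 h3
      linarith)
  rw [← Measure.restrict_congr_set Iio_ae_eq_Iic, Filter.EventuallyEq,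
    ae_restrict_iff' measurableSet_Iio]
  filter_upwards [key] with x hx hx0
  exact sub_eq_zero.1 (hx hx0)

/-- The weighted Sobolev space `W^{1,2}_w`, as a subspace of `L²_w`: the classes `f ∈ L²_w`
that lie in `L²_loc` and have a weak derivative in `L²_loc` which belongs to `L²_w`, i.e. for which
`∫ (|f|² + |f'|²) w` is finite. -/
def W12 (w : Weight) : Submodule ℝ (L2w w) where
  carrier := {f | ∃ g : L2w w, HasWeakDeriv f g}
  zero_mem' := by
    have h0 : (0 : ℝ → ℝ) =ᵐ[volume.restrict (Iic (0 : ℝ))] (0 : L2w w) :=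
      (w.absolutelyContinuous_measure.ae_eq (Lp.coeFn_zero ℝ 2 w.measure)).symm
    exact ⟨0, HasWeakDeriv.zero.congr h0 h0⟩
  add_mem' := by
    rintro f f' ⟨g, hg⟩ ⟨g', hg'⟩
    exact ⟨g + g', (hg.add hg').congr
      (w.absolutelyContinuous_measure.ae_eq (Lp.coeFn_add f f')).symm
      (w.absolutelyContinuous_measure.ae_eq (Lp.coeFn_add g g')).symm⟩
  smul_mem' := by
    rintro c f ⟨g, hg⟩
    exact ⟨c • g, (hg.const_smul c).congr
      (w.absolutelyContinuous_measure.ae_eq (Lp.coeFn_smul c f)).symm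
      (w.absolutelyContinuous_measure.ae_eq (Lp.coeFn_smul c g)).symm⟩

theorem HasWeakDeriv.unique_L2w {w : Weight} {f : ℝ → ℝ} {g g' : L2w w}
    (h : HasWeakDeriv f g) (h' : HasWeakDeriv f g') : g = g' :=
  Lp.ext (w.measure_absolutelyContinuous.ae_eq (h.unique h'))

/-- The weak derivative `f ↦ f'`, as a linear map `W^{1,2}_w → L²_w`. -/
def weakDeriv (w : Weight) : W12 w →ₗ[ℝ] L2w w where
  toFun f := Classical.choose f.2
  map_add' f f' := by
    refine (Classical.choose_spec (f + f').2).unique_L2w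
      (((Classical.choose_spec f.2).add (Classical.choose_spec f'.2)).congr ?_ ?_)
    · exact (w.absolutelyContinuous_measure.ae_eq (Lp.coeFn_add _ _)).symm
    · exact (w.absolutelyContinuous_measure.ae_eq (Lp.coeFn_add _ _)).symm
  map_smul' c f := by
    refine (Classical.choose_spec (c • f).2).unique_L2w
      (((Classical.choose_spec f.2).const_smul c).congr ?_ ?_)
    · exact (w.absolutelyContinuous_measure.ae_eq (Lp.coeFn_smul _ _)).symm
    · exact (w.absolutelyContinuous_measure.ae_eq (Lp.coeFn_smul _ _)).symm

theorem hasWeakDeriv_weakDeriv {w : Weight} (f : W12 w) :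
    HasWeakDeriv (f : L2w w) (weakDeriv w f) := Classical.choose_spec f.2

/-- `F` is a locally absolutely continuous version of the class `f` on `(-∞, 0]`. -/
structure IsACVersion {w : Weight} (f : L2w w) (F : ℝ → ℝ) : Prop where
  ae_eq : F =ᵐ[w.measure] f
  locallyAC : ∀ a ≤ 0, AbsolutelyContinuousOnInterval F a 0

/-- `f(0) = c`, where `f(0)` is the value at `0` of the locally absolutely continuous version
of `f`. -/
def HasValueAtZero {w : Weight} (f : L2w w) (c : ℝ) : Prop :=
  ∃ F : ℝ → ℝ, IsACVersion f F ∧ F 0 = c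

/-- The value at `0` does not depend on the version. -/
theorem HasValueAtZero.unique {w : Weight} {f : L2w w} {c d : ℝ}
    (hc : HasValueAtZero f c) (hd : HasValueAtZero f d) : c = d := by
  obtain ⟨F, hF, rfl⟩ := hc
  obtain ⟨G, hG, rfl⟩ := hd
  have hae : F =ᵐ[volume.restrict (Icc (-1 : ℝ) 0)] G :=
    ae_restrict_of_ae_restrict_of_subset Icc_subset_Iic_self
      (w.absolutelyContinuous_measure.ae_eq (hF.ae_eq.trans hG.ae_eq.symm))
  have hu : uIcc (-1 : ℝ) 0 = Icc (-1) 0 := uIcc_of_le (by norm_num)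
  have hFc := (hF.locallyAC (-1) (by norm_num)).continuousOn
  have hGc := (hG.locallyAC (-1) (by norm_num)).continuousOn
  rw [hu] at hFc hGc
  exact Measure.eqOn_Icc_of_ae_eq volume (by norm_num) hae hFc hGc (by norm_num)

/-- The operator `𝒜` on `H_w`: its domain is the set of `(x₀, x₁)` with `x₁ ∈ W^{1,2}_w` and
`x₀ = x₁(0)`, and `𝒜 (x₀, x₁) = (0, x₁')`. -/
def opA (w : Weight) : Hw w →ₗ.[ℝ] Hw w where
  domain :=
    { carrier := {x | x.snd ∈ W12 w ∧ HasValueAtZero x.snd x.fst}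
      zero_mem' := by
        refine ⟨(W12 w).zero_mem, fun _ => 0, ⟨(Lp.coeFn_zero ℝ 2 w.measure).symm, ?_⟩, rfl⟩
        intro a _
        exact (LipschitzWith.const (0 : ℝ)).lipschitzOnWith.absolutelyContinuousOnInterval
      add_mem' := by
        rintro x y ⟨hx, F, hF, hF0⟩ ⟨hy, G, hG, hG0⟩
        refine ⟨(W12 w).add_mem hx hy, F + G,
          ⟨(hF.ae_eq.add hG.ae_eq).trans (Lp.coeFn_add x.snd y.snd).symm, ?_⟩, ?_⟩
        · exact fun a ha => (hF.locallyAC a ha).add (hG.locallyAC a ha)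
        · simp [hF0, hG0]
      smul_mem' := by
        rintro c x ⟨hx, F, hF, hF0⟩
        refine ⟨(W12 w).smul_mem c hx, c • F,
          ⟨(hF.ae_eq.const_smul c).trans (Lp.coeFn_smul c x.snd).symm, ?_⟩, ?_⟩
        · exact fun a ha => (hF.locallyAC a ha).const_smul c
        · simp [hF0] }
  toFun :=
    { toFun := fun x => WithLp.toLp 2 (0, weakDeriv w ⟨(x : Hw w).snd, x.2.1⟩)
      map_add' := by
        intro x y
        rw [← WithLp.toLp_add, Prod.mk_add_mk, add_zero, ← map_add]
        rfl
      map_smul' := by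
        intro c x
        rw [RingHom.id_apply, ← WithLp.toLp_smul, Prod.smul_mk, smul_zero, ← map_smul]
        rfl }

end WeightedDelay

end

open WeightedDelay

/-!
On `(-∞, 0]`, having a weak derivative in `L²_loc` is the same as having a locally absolutely
continuous version: two functions with the same weak derivative differ by a constant (du
Bois-Reymond), and primitives of `L²_loc` functions are absolutely continuous.

For `f, g ∈ W^{1,2}_w` one integrates by parts in `∫ f' (g w)`. There is no boundary term at `-∞`,
since `f g w` is integrable with integrable derivative, while the boundary term `f(0) g(0)` at `0`
is the pairing of `x₀ = f(0)` with the first component of `𝒜* y`; as `(g w)' = (g' + g w'/w) w`,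
the asserted formula defines a formal adjoint of `𝒜`.

Conversely, let `z = 𝒜* y`. Test functions supported away from `0` show that `y₁ w` has weak
derivative `-z₁ w`. Dividing by `w`, `y₁` has weak derivative `-z₁ - y₁ w'/w`, which lies in `L²_w`
because `w'/w` is bounded.
-/

namespace WeightedDelay

open Filter Topology
open scoped ENNReal

section HalfLine

variable {b : ℝ}

theorem ae_restrict_Iic_of_forall_Icc {μ : Measure ℝ} {p : ℝ → Prop}
    (h : ∀ a ≤ b, ∀ᵐ x ∂μ, x ∈ Icc a b → p x) : ∀ᵐ x ∂μ.restrict (Iic b), p x := by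
  have hall : ∀ᵐ x ∂μ, ∀ n : ℕ, x ∈ Icc (b - n) b → p x := ae_all_iff.2 fun n => h _ (by simp)
  rw [ae_restrict_iff' measurableSet_Iic]
  filter_upwards [hall] with x hx hxb
  obtain ⟨n, hn⟩ := exists_nat_ge (b - x)
  exact hx n ⟨by linarith, hxb⟩

theorem ae_restrict_Iic_lt {μ : Measure ℝ} [NullSingletonClass μ] :
    ∀ᵐ x ∂μ.restrict (Iic b), x < b := by
  rw [← Measure.restrict_congr_set Iio_ae_eq_Iic]
  exact ae_restrict_mem measurableSet_Iio

theorem eq_zero_of_tendsto_atBot_of_integrableOn_Iic {E : Type*} [NormedAddCommGroup E]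
    {f : ℝ → E} {c : E} (hf : IntegrableOn f (Iic b)) (hc : Tendsto f atBot (𝓝 c)) : c = 0 := by
  refine IntegrableAtFilter.eq_zero_of_tendsto (μ := volume) ⟨Iic b, Iic_mem_atBot b, hf⟩ ?_ hc
  intro s hs
  obtain ⟨a, ha⟩ := mem_atBot_sets.1 hs
  exact top_le_iff.1 (Real.volume_Iic (a := a) ▸ measure_mono ha)

/-- Local absolute continuity on the half-line `(-∞, b]`: absolute continuity on each compact
interval `[a, b]`. For `b = 0` this is the regularity required by `IsACVersion`. -/
def LocallyACOnIic (F : ℝ → ℝ) (b : ℝ) : Prop :=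
  ∀ a ≤ b, AbsolutelyContinuousOnInterval F a b

namespace LocallyACOnIic

variable {F G : ℝ → ℝ}

theorem of_contDiffOn (hF : ContDiffOn ℝ 1 F (Iic b)) : LocallyACOnIic F b := fun _ ha =>
  (hF.mono (uIcc_of_le ha ▸ Icc_subset_Iic_self)).absolutelyContinuousOnInterval

theorem add_const (hF : LocallyACOnIic F b) (c : ℝ) : LocallyACOnIic (fun x => F x + c) b :=
  fun a ha => (hF a ha).fun_add
    (LipschitzWith.const c).lipschitzOnWith.absolutelyContinuousOnInterval

theorem mul (hF : LocallyACOnIic F b) (hG : LocallyACOnIic G b) :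
    LocallyACOnIic (fun x => F x * G x) b := fun a ha => (hF a ha).fun_mul (hG a ha)

theorem continuousOn (hF : LocallyACOnIic F b) : ContinuousOn F (Iic b) := by
  intro x hx
  have hlt : x - 1 < x := sub_one_lt x
  have hcont : ContinuousOn F (Icc (x - 1) b) :=
    uIcc_of_le (hlt.le.trans hx) ▸ (hF (x - 1) (hlt.le.trans hx)).continuousOn
  refine (hcont x ⟨hlt.le, hx⟩).mono_of_mem_nhdsWithin ?_
  rw [← Ici_inter_Iic]
  exact inter_mem (mem_nhdsWithin_of_mem_nhds (Ici_mem_nhds hlt)) self_mem_nhdsWithin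

theorem ae_differentiableAt (hF : LocallyACOnIic F b) :
    ∀ᵐ x ∂volume.restrict (Iic b), DifferentiableAt ℝ F x :=
  ae_restrict_Iic_of_forall_Icc fun a ha => by
    simpa only [uIcc_of_le ha] using (hF a ha).ae_differentiableAt

theorem deriv_mul_ae_eq (hF : LocallyACOnIic F b) (hG : LocallyACOnIic G b) :
    deriv (fun x => F x * G x) =ᵐ[volume.restrict (Iic b)]
      fun x => deriv F x * G x + F x * deriv G x := by
  filter_upwards [hF.ae_differentiableAt, hG.ae_differentiableAt] with x hFx hGx
  exact deriv_fun_mul hFx hGx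

theorem tendsto_atBot (hF : LocallyACOnIic F b) (hF' : IntegrableOn (deriv F) (Iic b)) :
    Tendsto F atBot (𝓝 (F b - ∫ x in Iic b, deriv F x)) := by
  refine (tendsto_const_nhds.sub
    (intervalIntegral_tendsto_integral_Iic b hF' tendsto_id)).congr' ?_
  filter_upwards [eventually_le_atBot b] with a ha
  rw [id, (hF a ha).integral_deriv_eq_sub, sub_sub_cancel]

theorem integral_Iic_deriv (hF : LocallyACOnIic F b) (hint : IntegrableOn F (Iic b))
    (hF' : IntegrableOn (deriv F) (Iic b)) : ∫ x in Iic b, deriv F x = F b :=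
  (sub_eq_zero.1
    (eq_zero_of_tendsto_atBot_of_integrableOn_Iic hint (hF.tendsto_atBot hF'))).symm

theorem integral_Iic_deriv_mul_eq_sub (hF : LocallyACOnIic F b) (hG : LocallyACOnIic G b)
    (hFG : IntegrableOn (fun x => F x * G x) (Iic b))
    (hF'G : IntegrableOn (fun x => deriv F x * G x) (Iic b))
    (hFG' : IntegrableOn (fun x => F x * deriv G x) (Iic b)) :
    ∫ x in Iic b, deriv F x * G x = F b * G b - ∫ x in Iic b, F x * deriv G x := by
  have hderiv := hF.deriv_mul_ae_eq hG
  have key := (hF.mul hG).integral_Iic_deriv hFG ((hF'G.add hFG').congr hderiv.symm)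
  rw [integral_congr_ae hderiv, integral_add hF'G hFG'] at key
  exact eq_sub_of_add_eq key

end LocallyACOnIic

theorem deriv_ae_eq_derivWithin_Iic {E : Type*} [NormedAddCommGroup E] [NormedSpace ℝ E]
    (f : ℝ → E) : deriv f =ᵐ[volume.restrict (Iic b)] derivWithin f (Iic b) := by
  filter_upwards [ae_restrict_Iic_lt] with x hx
  exact (derivWithin_of_mem_nhds (Iic_mem_nhds hx)).symm

theorem support_intervalIntegral_subset_Icc {E : Type*} [NormedAddCommGroup E] [NormedSpace ℝ E]
    {a : ℝ} {f : ℝ → E} (hf : Function.support f ⊆ Icc a b) (h0 : ∫ x, f x = 0) :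
    Function.support (fun x => ∫ t in a..x, f t) ⊆ Icc a b := by
  refine Function.support_subset_iff'.2 fun x hx => ?_
  have hzero : ∀ t ∉ Icc a b, f t = 0 := Function.support_subset_iff'.1 hf
  rcases lt_or_ge x a with hxa | hax
  · rw [intervalIntegral.integral_symm, intervalIntegral.integral_of_le hxa.le,
      ← integral_Ico_eq_integral_Ioc, setIntegral_eq_zero_of_forall_eq_zero, neg_zero]
    exact fun t ht => hzero t fun h => ht.2.not_ge h.1
  · have hbx : b < x := not_le.1 fun h => hx ⟨hax, h⟩
    rw [intervalIntegral.integral_of_le hax, ← integral_Icc_eq_integral_Ioc,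
      setIntegral_eq_integral_of_forall_compl_eq_zero, h0]
    exact fun t ht => hzero t fun h => ht ⟨h.1, h.2.trans hbx.le⟩

end HalfLine

/-- Test functions `φ ∈ C¹_c((-∞, 0))`, extended by zero to `ℝ`: the class against which
`HasWeakDeriv` is tested. -/
structure IsTestFunction (φ : ℝ → ℝ) : Prop where
  contDiff : ContDiff ℝ 1 φ
  hasCompactSupport : HasCompactSupport φ
  tsupport_subset : tsupport φ ⊆ Iio 0

namespace IsTestFunction

variable {φ ψ : ℝ → ℝ}

theorem eq_zero_of_nonneg (hφ : IsTestFunction φ) {x : ℝ} (hx : 0 ≤ x) : φ x = 0 :=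
  image_eq_zero_of_notMem_tsupport fun h => (mem_Iio.1 (hφ.tsupport_subset h)).not_ge hx

theorem setIntegral_Iic_mul (hφ : IsTestFunction φ) (f : ℝ → ℝ) :
    ∫ x in Iic 0, f x * φ x = ∫ x, f x * φ x :=
  setIntegral_eq_integral_of_forall_compl_eq_zero fun x hx => by
    rw [hφ.eq_zero_of_nonneg (not_le.1 hx).le, mul_zero]

theorem integrable (hφ : IsTestFunction φ) : Integrable φ :=
  hφ.contDiff.continuous.integrable_of_hasCompactSupport hφ.hasCompactSupport

theorem sub_const_smul (hφ : IsTestFunction φ) (hψ : IsTestFunction ψ) (c : ℝ) :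
    IsTestFunction (φ - c • ψ) where
  contDiff := hφ.contDiff.sub (hψ.contDiff.const_smul c)
  hasCompactSupport := hφ.hasCompactSupport.sub (hψ.hasCompactSupport.smul_left (f := fun _ => c))
  tsupport_subset := (tsupport_sub φ (c • ψ)).trans (union_subset hφ.tsupport_subset
    ((closure_mono (Function.support_const_smul_subset c ψ)).trans hψ.tsupport_subset))

theorem exists_integral_eq_one : ∃ ρ : ℝ → ℝ, IsTestFunction ρ ∧ ∫ x, ρ x = 1 := by
  let B : ContDiffBump (-2 : ℝ) := ⟨1 / 2, 1, by norm_num, by norm_num⟩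
  refine ⟨B.normed volume, ⟨B.contDiff_normed, B.hasCompactSupport_normed, ?_⟩, B.integral_normed⟩
  rw [B.tsupport_normed_eq, Real.closedBall_eq_Icc]
  exact fun x hx => hx.2.trans_lt (by norm_num)

theorem exists_tsupport_subset_Icc (hφ : IsTestFunction φ) :
    ∃ a b : ℝ, b < 0 ∧ tsupport φ ⊆ Icc a b := by
  obtain ⟨a, ha⟩ := hφ.hasCompactSupport.isCompact.bddBelow
  rcases (tsupport φ).eq_empty_or_nonempty with hempty | hne
  · exact ⟨0, -1, by norm_num, hempty ▸ empty_subset _⟩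
  · obtain ⟨b, hb, hmax⟩ := hφ.hasCompactSupport.isCompact.exists_isGreatest hne
    exact ⟨a, b, hφ.tsupport_subset hb, fun x hx => ⟨ha hx, hmax hx⟩⟩

theorem exists_primitive (hψ : IsTestFunction ψ) (h0 : ∫ x, ψ x = 0) :
    ∃ φ : ℝ → ℝ, IsTestFunction φ ∧ deriv φ = ψ := by
  obtain ⟨a, b, hb, hab⟩ := hψ.exists_tsupport_subset_Icc
  have hcont := hψ.contDiff.continuous
  have hderiv : deriv (fun x => ∫ t in a..x, ψ t) = ψ := funext (hcont.deriv_integral ψ a)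
  have hsupp : tsupport (fun x => ∫ t in a..x, ψ t) ⊆ Icc a b := closure_minimal
    (support_intervalIntegral_subset_Icc ((subset_tsupport ψ).trans hab) h0) isClosed_Icc
  refine ⟨fun x => ∫ t in a..x, ψ t, ⟨contDiff_one_iff_deriv.2 ⟨fun x => ?_, ?_⟩, ?_, ?_⟩, hderiv⟩
  · exact (hcont.integral_hasStrictDerivAt a x).hasDerivAt.differentiableAt
  · rwa [hderiv]
  · exact isCompact_Icc.of_isClosed_subset (isClosed_tsupport _) hsupp
  · exact fun x hx => (hsupp hx).2.trans_lt hb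

end IsTestFunction

namespace MemL2loc

variable {f g : ℝ → ℝ}

theorem of_continuousOn (hf : ContinuousOn f (Iic 0)) : MemL2loc f := fun a => by
  have hIcc : ContinuousOn f (Icc a 0) := hf.mono Icc_subset_Iic_self
  rw [memLp_two_iff_integrable_sq (hIcc.aestronglyMeasurable measurableSet_Icc)]
  exact (hIcc.pow 2).integrableOn_Icc

theorem sub (hf : MemL2loc f) (hg : MemL2loc g) : MemL2loc (f - g) :=
  fun a => (hf a).sub (hg a)

theorem mul_continuousOn (hf : MemL2loc f) (hg : ContinuousOn g (Iic 0)) :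
    MemL2loc (fun x => f x * g x) := fun a => by
  have hIcc : ContinuousOn g (Icc a 0) := hg.mono Icc_subset_Iic_self
  have hmeas := (hf a).aestronglyMeasurable
  refine (memLp_two_iff_integrable_sq
    (hmeas.mul (hIcc.aestronglyMeasurable measurableSet_Icc))).2 ?_
  simp only [Pi.mul_apply, mul_pow]
  exact IntegrableOn.mul_continuousOn ((memLp_two_iff_integrable_sq hmeas).1 (hf a)) (hIcc.pow 2)
    isCompact_Icc

theorem locallyIntegrableOn_Iio (hf : MemL2loc f) : LocallyIntegrableOn f (Iio 0) :=
  fun x hx => ⟨Icc (x - 1) 0,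
    mem_nhdsWithin_of_mem_nhds (Icc_mem_nhds (sub_one_lt x) hx), hf.integrableOn _⟩

theorem ae_eq_zero_of_forall_integral_mul_eq_zero (hf : MemL2loc f)
    (h : ∀ φ, IsTestFunction φ → ∫ x in Iic 0, f x * φ x = 0) :
    f =ᵐ[volume.restrict (Iic 0)] 0 := by
  rw [← Measure.restrict_congr_set Iio_ae_eq_Iic, EventuallyEq, ae_restrict_iff' measurableSet_Iio]
  refine isOpen_Iio.ae_eq_zero_of_integral_contDiff_smul_eq_zero hf.locallyIntegrableOn_Iio
    fun φ hφ hc hs => ?_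
  have htest : IsTestFunction φ := ⟨hφ.of_le (mod_cast le_top), hc, hs⟩
  simpa only [smul_eq_mul, mul_comm, htest.setIntegral_Iic_mul] using h φ htest

theorem intervalIntegrable (hf : MemL2loc f) {a : ℝ} (ha : a ≤ 0) :
    IntervalIntegrable f volume a 0 :=
  (intervalIntegrable_iff_integrableOn_Icc_of_le ha).2 (hf.integrableOn a)

theorem locallyACOnIic_integral (hf : MemL2loc f) :
    LocallyACOnIic (fun x => ∫ t in (0 : ℝ)..x, f t) 0 := fun _ ha =>
  (hf.intervalIntegrable ha).absolutelyContinuousOnInterval_intervalIntegral right_mem_uIcc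

theorem deriv_integral_ae_eq (hf : MemL2loc f) :
    deriv (fun x => ∫ t in (0 : ℝ)..x, f t) =ᵐ[volume.restrict (Iic 0)] f := by
  refine ae_restrict_Iic_of_forall_Icc fun a ha => ?_
  filter_upwards [(hf.intervalIntegrable ha).ae_hasDerivAt_integral] with x hx hxa
  exact (hx (uIcc_of_le ha ▸ hxa) 0 right_mem_uIcc).deriv

end MemL2loc

theorem LocallyACOnIic.hasWeakDeriv {F g : ℝ → ℝ} (hF : LocallyACOnIic F 0) (hg : MemL2loc g)
    (hderiv : deriv F =ᵐ[volume.restrict (Iic 0)] g) : HasWeakDeriv F g := by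
  have hF2 : MemL2loc F := .of_continuousOn hF.continuousOn
  have hF2' : MemL2loc (deriv F) := hg.congr hderiv.symm
  refine HasWeakDeriv.congr ⟨hF2, hF2', fun φ hφ hc hs => ?_⟩ .rfl hderiv
  have hparts := hF.integral_Iic_deriv_mul_eq_sub (.of_contDiffOn hφ.contDiffOn)
    (hF2.integrable_mul hφ.continuous hc) (hF2'.integrable_mul hφ.continuous hc)
    (hF2.integrable_mul (hφ.continuous_deriv le_rfl) hc.deriv)
  rw [hparts, IsTestFunction.eq_zero_of_nonneg ⟨hφ, hc, hs⟩ le_rfl]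
  ring

namespace HasWeakDeriv

variable {f g h ψ : ℝ → ℝ}

theorem integral_mul_eq_zero (hf : HasWeakDeriv f 0) (hψ : IsTestFunction ψ)
    (h0 : ∫ x, ψ x = 0) : ∫ x in Iic 0, f x * ψ x = 0 := by
  obtain ⟨φ, hφ, rfl⟩ := hψ.exists_primitive h0
  simpa using hf.integral_eq φ hφ.contDiff hφ.hasCompactSupport hφ.tsupport_subset

theorem exists_ae_eq_const (hf : HasWeakDeriv f 0) :
    ∃ c : ℝ, f =ᵐ[volume.restrict (Iic 0)] fun _ => c := by
  obtain ⟨ρ, hρ, hρ1⟩ := IsTestFunction.exists_integral_eq_one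
  set c := ∫ x in Iic 0, f x * ρ x
  have hc : MemL2loc fun _ => c := .of_continuousOn continuousOn_const
  have hint : ∀ {k φ : ℝ → ℝ}, MemL2loc k → IsTestFunction φ →
      IntegrableOn (fun x => k x * φ x) (Iic 0) := fun hk hφ =>
    hk.integrable_mul hφ.contDiff.continuous hφ.hasCompactSupport
  have hzero : f - (fun _ => c) =ᵐ[volume.restrict (Iic 0)] 0 := by
    refine (hf.left_mem.sub hc).ae_eq_zero_of_forall_integral_mul_eq_zero fun ψ hψ => ?_
    set m := ∫ x, ψ x
    have hmean : ∫ x, (ψ - m • ρ) x = 0 := by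
      simp only [Pi.sub_apply, Pi.smul_apply, smul_eq_mul]
      rw [integral_sub hψ.integrable (hρ.integrable.const_mul m), integral_const_mul, hρ1, mul_one,
        sub_self]
    have horth : ∫ x in Iic 0, f x * ψ x = m * c := by
      have h := hf.integral_mul_eq_zero (hψ.sub_const_smul hρ m) hmean
      simp only [Pi.sub_apply, Pi.smul_apply, smul_eq_mul, mul_sub, mul_left_comm _ m] at h
      rwa [integral_sub (hint hf.left_mem hψ) ((hint hf.left_mem hρ).const_mul m),
        integral_const_mul, sub_eq_zero] at h
    simp only [Pi.sub_apply, sub_mul]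
    rw [integral_sub (hint hf.left_mem hψ) (hint hc hψ), horth, hψ.setIntegral_Iic_mul,
      integral_const_mul, mul_comm, sub_self]
  exact ⟨c, hzero.mono fun _ => sub_eq_zero.1⟩

theorem exists_locallyACOnIic (hf : HasWeakDeriv f g) :
    ∃ F : ℝ → ℝ, LocallyACOnIic F 0 ∧ F =ᵐ[volume.restrict (Iic 0)] f ∧
      deriv F =ᵐ[volume.restrict (Iic 0)] g := by
  set G : ℝ → ℝ := fun x => ∫ t in (0 : ℝ)..x, g t
  have hG : LocallyACOnIic G 0 := hf.right_mem.locallyACOnIic_integral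
  have hG' : deriv G =ᵐ[volume.restrict (Iic 0)] g := hf.right_mem.deriv_integral_ae_eq
  have hdiff : HasWeakDeriv (f - G) 0 := by
    simpa only [neg_one_smul, ← sub_eq_add_neg, sub_self] using
      hf.add ((hG.hasWeakDeriv hf.right_mem hG').const_smul (-1))
  obtain ⟨c, hc⟩ := hdiff.exists_ae_eq_const
  refine ⟨fun x => G x + c, hG.add_const c, ?_, by rwa [deriv_add_const']⟩
  filter_upwards [hc] with x hx
  rw [← hx, Pi.sub_apply, add_sub_cancel]

theorem mul_contDiffOn (hf : HasWeakDeriv f g) (hh : ContDiffOn ℝ 1 h (Iic 0)) :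
    HasWeakDeriv (fun x => f x * h x) (fun x => g x * h x + f x * derivWithin h (Iic 0) x) := by
  obtain ⟨F, hF, hFf, hFg⟩ := hf.exists_locallyACOnIic
  have hh' : ContinuousOn (derivWithin h (Iic 0)) (Iic 0) :=
    hh.continuousOn_derivWithin (uniqueDiffOn_Iic 0) le_rfl
  have hFh : LocallyACOnIic h 0 := .of_contDiffOn hh
  refine ((hF.mul hFh).hasWeakDeriv ((hf.right_mem.mul_continuousOn hh.continuousOn).add
    (hf.left_mem.mul_continuousOn hh')) ?_).congr (hFf.mul .rfl) .rfl
  filter_upwards [hF.deriv_mul_ae_eq hFh, deriv_ae_eq_derivWithin_Iic h, hFf, hFg]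
    with x hmul hhx hfx hgx
  rw [hmul, hhx, hfx, hgx]
  rfl

end HasWeakDeriv

namespace Weight

variable (w : Weight)

theorem continuousOn : ContinuousOn w (Iic 0) := w.contDiffOn.continuousOn

theorem ne_zero {ξ : ℝ} (hξ : ξ ∈ Iic (0 : ℝ)) : w ξ ≠ 0 := (w.pos ξ hξ).ne'

theorem contDiffOn_inv : ContDiffOn ℝ 1 (fun ξ => (w ξ)⁻¹) (Iic 0) :=
  w.contDiffOn.inv fun _ => w.ne_zero

theorem aemeasurable_ofReal :
    AEMeasurable (fun ξ => ENNReal.ofReal (w ξ)) (volume.restrict (Iic 0)) :=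
  (w.continuousOn.aemeasurable measurableSet_Iic).ennreal_ofReal

theorem ae_measure : ae w.measure = ae (volume.restrict (Iic 0)) :=
  le_antisymm w.measure_absolutelyContinuous.ae_le w.absolutelyContinuous_measure.ae_le

theorem integral_measure (f : ℝ → ℝ) :
    ∫ ξ, f ξ ∂w.measure = ∫ ξ in Iic 0, f ξ * w ξ := by
  rw [measure, integral_withDensity_eq_integral_toReal_smul₀ w.aemeasurable_ofReal (by simp)]
  refine setIntegral_congr_fun measurableSet_Iic fun ξ hξ => ?_
  simp only [ENNReal.toReal_ofReal (w.pos ξ hξ).le, smul_eq_mul, mul_comm]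

theorem integrable_measure_iff {f : ℝ → ℝ} :
    Integrable f w.measure ↔ IntegrableOn (fun ξ => f ξ * w ξ) (Iic 0) := by
  rw [measure, integrable_withDensity_iff_integrable_smul₀' w.aemeasurable_ofReal (by simp)]
  refine integrable_congr ?_
  filter_upwards [ae_restrict_mem measurableSet_Iic] with ξ hξ
  simp only [ENNReal.toReal_ofReal (w.pos ξ hξ).le, smul_eq_mul, mul_comm]

variable {w} in
theorem memL2loc (f : L2w w) : MemL2loc f := fun a => by
  have hac : volume.restrict (Icc a 0) ≪ w.measure :=
    (Measure.restrict_mono_set _ Icc_subset_Iic_self).absolutelyContinuous.trans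
      w.absolutelyContinuous_measure
  have hmeas := (Lp.memLp f).aestronglyMeasurable
  have hsq : IntegrableOn (fun ξ => f ξ ^ 2 * w ξ) (Icc a 0) :=
    (w.integrable_measure_iff.1 ((memLp_two_iff_integrable_sq hmeas).1 (Lp.memLp f))).mono_set
      Icc_subset_Iic_self
  have hinv : ContinuousOn (fun ξ => (w ξ)⁻¹) (Icc a 0) :=
    w.contDiffOn_inv.continuousOn.mono Icc_subset_Iic_self
  rw [memLp_two_iff_integrable_sq (hmeas.mono_ac hac)]
  refine (hsq.mul_continuousOn hinv isCompact_Icc).congr_fun (fun ξ hξ => ?_) measurableSet_Icc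
  exact mul_inv_cancel_right₀ (w.ne_zero hξ.2) _

theorem memLp_of_hasCompactSupport {φ : ℝ → ℝ} (hφ : Continuous φ) (hc : HasCompactSupport φ) :
    MemLp φ 2 w.measure := by
  rw [memLp_two_iff_integrable_sq hφ.aestronglyMeasurable, w.integrable_measure_iff]
  have hsq : HasCompactSupport fun ξ => φ ξ ^ 2 :=
    hc.comp_left (g := (· ^ 2)) (zero_pow two_ne_zero)
  simpa only [Pi.pow_apply, mul_comm] using
    (MemL2loc.of_continuousOn w.continuousOn).integrable_mul (hφ.pow 2) hsq

theorem memLp_top_logDeriv : MemLp (fun ξ => w.deriv ξ / w ξ) ∞ w.measure := by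
  obtain ⟨K, hK⟩ := w.bounded
  have hcont : ContinuousOn (fun ξ => w.deriv ξ / w ξ) (Iic 0) :=
    (w.contDiffOn.continuousOn_derivWithin (uniqueDiffOn_Iic 0) le_rfl).div w.continuousOn
      fun _ => w.ne_zero
  refine memLp_top_of_bound
    ((hcont.aestronglyMeasurable measurableSet_Iic).mono_ac w.measure_absolutelyContinuous) K ?_
  rw [ae_measure]
  filter_upwards [ae_restrict_mem measurableSet_Iic] with ξ hξ using hK ξ hξ

/-- Multiplication by the logarithmic derivative `w' / w`, a bounded function, as a linear map
of `L²_w`. -/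
noncomputable def mulLogDeriv : L2w w →ₗ[ℝ] L2w w :=
  (ContinuousLinearMap.mul ℝ ℝ).holderₗ w.measure ∞ 2 2 w.memLp_top_logDeriv.toLp

theorem coeFn_mulLogDeriv (f : L2w w) :
    w.mulLogDeriv f =ᵐ[w.measure] fun ξ => f ξ * (w.deriv ξ / w ξ) := by
  filter_upwards [(ContinuousLinearMap.mul ℝ ℝ).coeFn_holder (r := 2) w.memLp_top_logDeriv.toLp f,
    w.memLp_top_logDeriv.coeFn_toLp] with ξ hmul hlog
  rw [← hlog, mul_comm]
  exact hmul

end Weight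

variable {w : Weight}

section Inner

variable {f g : L2w w} {F G : ℝ → ℝ}

theorem mul_ae_eq_of_ae_eq_mul_weight (hF : F =ᵐ[volume.restrict (Iic 0)] f)
    (hG : G =ᵐ[volume.restrict (Iic 0)] fun ξ => g ξ * w ξ) :
    (fun ξ => f ξ * g ξ * w ξ) =ᵐ[volume.restrict (Iic 0)] fun ξ => F ξ * G ξ := by
  filter_upwards [hF, hG] with ξ hFξ hGξ
  rw [hFξ, hGξ, mul_assoc]

theorem inner_L2w_eq_setIntegral (hF : F =ᵐ[volume.restrict (Iic 0)] f)
    (hG : G =ᵐ[volume.restrict (Iic 0)] fun ξ => g ξ * w ξ) :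
    inner ℝ f g = ∫ ξ in Iic 0, F ξ * G ξ := by
  rw [L2.inner_def, ← integral_congr_ae (mul_ae_eq_of_ae_eq_mul_weight hF hG), ← w.integral_measure]
  simp only [RCLike.inner_apply, conj_trivial, mul_comm]

theorem integrableOn_mul_of_ae_eq (hF : F =ᵐ[volume.restrict (Iic 0)] f)
    (hG : G =ᵐ[volume.restrict (Iic 0)] fun ξ => g ξ * w ξ) :
    IntegrableOn (fun ξ => F ξ * G ξ) (Iic 0) :=
  (w.integrable_measure_iff.1 ((Lp.memLp f).integrable_mul (Lp.memLp g))).congr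
    (mul_ae_eq_of_ae_eq_mul_weight hF hG)

end Inner

theorem inner_Hw (x y : Hw w) : inner ℝ x y = x.fst * y.fst + inner ℝ x.snd y.snd := by
  rw [WithLp.prod_inner_apply, RCLike.inner_apply, conj_trivial, mul_comm]
  rfl

theorem HasWeakDeriv.weakDeriv_eq {f g : L2w w} (h : HasWeakDeriv f g) :
    weakDeriv w ⟨f, g, h⟩ = g :=
  (hasWeakDeriv_weakDeriv ⟨f, g, h⟩).unique_L2w h

theorem exists_isACVersion (f : W12 w) :
    ∃ F : ℝ → ℝ, IsACVersion (f : L2w w) F ∧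
      deriv F =ᵐ[volume.restrict (Iic 0)] weakDeriv w f := by
  obtain ⟨F, hF, hFf, hF'⟩ := (hasWeakDeriv_weakDeriv f).exists_locallyACOnIic
  exact ⟨F, ⟨w.measure_absolutelyContinuous.ae_eq hFf, hF⟩, hF'⟩

/-- The locally absolutely continuous version of `f ∈ W^{1,2}_w`; only its values on `(-∞, 0]` are
determined by `f`. -/
noncomputable def acVersion (f : W12 w) : ℝ → ℝ := (exists_isACVersion f).choose

theorem isACVersion_acVersion (f : W12 w) : IsACVersion (f : L2w w) (acVersion f) :=
  (exists_isACVersion f).choose_spec.1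

theorem locallyACOnIic_acVersion (f : W12 w) : LocallyACOnIic (acVersion f) 0 :=
  (isACVersion_acVersion f).locallyAC

theorem acVersion_ae_eq (f : W12 w) : acVersion f =ᵐ[volume.restrict (Iic 0)] f :=
  w.ae_measure ▸ (isACVersion_acVersion f).ae_eq

theorem deriv_acVersion_ae_eq (f : W12 w) :
    deriv (acVersion f) =ᵐ[volume.restrict (Iic 0)] weakDeriv w f :=
  (exists_isACVersion f).choose_spec.2

theorem HasValueAtZero.add {f g : L2w w} {c d : ℝ} :
    HasValueAtZero f c → HasValueAtZero g d → HasValueAtZero (f + g) (c + d) := by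
  rintro ⟨F, hF, rfl⟩ ⟨G, hG, rfl⟩
  exact ⟨F + G, ⟨(hF.ae_eq.add hG.ae_eq).trans (Lp.coeFn_add f g).symm,
    fun a ha => (hF.locallyAC a ha).add (hG.locallyAC a ha)⟩, rfl⟩

theorem HasValueAtZero.const_smul {f : L2w w} {d : ℝ} (c : ℝ) :
    HasValueAtZero f d → HasValueAtZero (c • f) (c • d) := by
  rintro ⟨F, hF, rfl⟩
  exact ⟨c • F, ⟨(hF.ae_eq.const_smul c).trans (Lp.coeFn_smul c f).symm,
    fun a ha => (hF.locallyAC a ha).const_smul c⟩, rfl⟩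

theorem hasValueAtZero_acVersion (f : W12 w) : HasValueAtZero (f : L2w w) (acVersion f 0) :=
  ⟨acVersion f, isACVersion_acVersion f, rfl⟩

variable (w) in
/-- The trace `f ↦ f(0)` as a linear functional on `W^{1,2}_w`. -/
noncomputable def valueAtZero : W12 w →ₗ[ℝ] ℝ where
  toFun f := acVersion f 0
  map_add' f g := (hasValueAtZero_acVersion (f + g)).unique
    ((hasValueAtZero_acVersion f).add (hasValueAtZero_acVersion g))
  map_smul' c f := (hasValueAtZero_acVersion (c • f)).unique
    ((hasValueAtZero_acVersion f).const_smul c)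

theorem hasValueAtZero_valueAtZero (f : W12 w) :
    HasValueAtZero (f : L2w w) (valueAtZero w f) := hasValueAtZero_acVersion f

theorem deriv_acVersion_mul_weight_ae_eq (f : W12 w) :
    deriv (fun ξ => acVersion f ξ * w ξ) =ᵐ[volume.restrict (Iic 0)]
      fun ξ => (weakDeriv w f + w.mulLogDeriv f) ξ * w ξ := by
  have hadd := Lp.coeFn_add (weakDeriv w f) (w.mulLogDeriv f)
  have hlog := w.coeFn_mulLogDeriv f
  rw [w.ae_measure] at hadd hlog
  filter_upwards [(locallyACOnIic_acVersion f).deriv_mul_ae_eq (.of_contDiffOn w.contDiffOn),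
    deriv_ae_eq_derivWithin_Iic w, acVersion_ae_eq f, deriv_acVersion_ae_eq f, hadd, hlog,
    ae_restrict_mem measurableSet_Iic] with ξ hmul hw hf hf' hadd hlog hξ
  rw [hmul, hw, hf, hf', hadd, Pi.add_apply, hlog, Weight.deriv, add_mul, mul_assoc,
    div_mul_cancel₀ _ (w.ne_zero hξ)]

theorem inner_weakDeriv (f g : W12 w) :
    inner ℝ (weakDeriv w f) (g : L2w w) = valueAtZero w f * valueAtZero w g -
      inner ℝ (f : L2w w) (weakDeriv w g + w.mulLogDeriv g) := by
  have hf := acVersion_ae_eq f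
  have hf' := deriv_acVersion_ae_eq f
  have hg : (fun ξ => acVersion g ξ * w ξ) =ᵐ[volume.restrict (Iic 0)]
      fun ξ => (g : L2w w) ξ * w ξ :=
    (acVersion_ae_eq g).mul .rfl
  have hg' := deriv_acVersion_mul_weight_ae_eq g
  rw [inner_L2w_eq_setIntegral hf' hg, inner_L2w_eq_setIntegral hf hg',
    (locallyACOnIic_acVersion f).integral_Iic_deriv_mul_eq_sub
      ((locallyACOnIic_acVersion g).mul (.of_contDiffOn w.contDiffOn))
      (integrableOn_mul_of_ae_eq hf hg) (integrableOn_mul_of_ae_eq hf' hg)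
      (integrableOn_mul_of_ae_eq hf hg'), w.map_zero, mul_one]
  rfl

variable (w) in
/-- The operator `(x₀, x₁) ↦ (x₁(0), -x₁' - x₁ w' / w)` on `{x | x₁ ∈ W^{1,2}_w}`, with `x₀`
unconstrained; it turns out to be `𝒜*`. -/
noncomputable def opAdjoint : Hw w →ₗ.[ℝ] Hw w where
  domain := (W12 w).comap (WithLp.sndₗ 2 ℝ ℝ (L2w w))
  toFun := (WithLp.linearEquiv 2 ℝ (ℝ × L2w w)).symm.toLinearMap ∘ₗ
    (valueAtZero w).prod (-(weakDeriv w + w.mulLogDeriv ∘ₗ (W12 w).subtype)) ∘ₗ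
      (WithLp.sndₗ 2 ℝ ℝ (L2w w)).submoduleComap (W12 w)

theorem opA_fst (x : (opA w).domain) : (opA w x).fst = 0 := rfl

theorem opA_snd (x : (opA w).domain) : (opA w x).snd = weakDeriv w ⟨(x : Hw w).snd, x.2.1⟩ := rfl

theorem opAdjoint_fst (x : (opAdjoint w).domain) :
    (opAdjoint w x).fst = valueAtZero w ⟨(x : Hw w).snd, x.2⟩ := rfl

theorem opAdjoint_snd (x : (opAdjoint w).domain) :
    (opAdjoint w x).snd =
      -(weakDeriv w ⟨(x : Hw w).snd, x.2⟩ + w.mulLogDeriv (x : Hw w).snd) := rfl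

theorem opAdjoint_snd_ae_eq (x : (opAdjoint w).domain) :
    (opAdjoint w x).snd =ᵐ[w.measure]
      fun ξ => -weakDeriv w ⟨(x : Hw w).snd, x.2⟩ ξ - (x : Hw w).snd ξ * (w.deriv ξ / w ξ) := by
  set f : W12 w := ⟨(x : Hw w).snd, x.2⟩
  rw [opAdjoint_snd]
  filter_upwards [Lp.coeFn_neg (weakDeriv w f + w.mulLogDeriv f),
    Lp.coeFn_add (weakDeriv w f) (w.mulLogDeriv f), w.coeFn_mulLogDeriv f] with ξ hneg hadd hlog
  rw [hneg, Pi.neg_apply, hadd, Pi.add_apply, hlog, neg_add']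

theorem opA_isFormalAdjoint_opAdjoint : (opA w).IsFormalAdjoint (opAdjoint w) := by
  intro x y
  set f : W12 w := ⟨(x : Hw w).snd, x.2.1⟩
  set g : W12 w := ⟨(y : Hw w).snd, y.2⟩
  have hx : (x : Hw w).fst = valueAtZero w f := x.2.2.unique (hasValueAtZero_valueAtZero f)
  rw [inner_Hw, inner_Hw, hx, opA_fst, zero_mul, zero_add, opA_snd, opAdjoint_fst, opAdjoint_snd,
    inner_neg_right, ← sub_eq_add_neg]
  exact inner_weakDeriv f g

theorem exists_mem_domain_opA (w : Weight) {φ : ℝ → ℝ} (hφ : ContDiff ℝ 1 φ)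
    (hc : HasCompactSupport φ) :
    ∃ x : (opA w).domain, (x : Hw w).fst = φ 0 ∧
      φ =ᵐ[volume.restrict (Iic 0)] (x : Hw w).snd ∧
      deriv φ =ᵐ[volume.restrict (Iic 0)] (opA w x).snd := by
  have hmem : MemLp φ 2 w.measure := w.memLp_of_hasCompactSupport hφ.continuous hc
  have hmem' : MemLp (deriv φ) 2 w.measure :=
    w.memLp_of_hasCompactSupport (hφ.continuous_deriv le_rfl) hc.deriv
  have hae : φ =ᵐ[volume.restrict (Iic 0)] hmem.toLp := w.ae_measure ▸ hmem.coeFn_toLp.symm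
  have hae' : deriv φ =ᵐ[volume.restrict (Iic 0)] hmem'.toLp :=
    w.ae_measure ▸ hmem'.coeFn_toLp.symm
  have hac : LocallyACOnIic φ 0 := .of_contDiffOn hφ.contDiffOn
  have hweak : HasWeakDeriv hmem.toLp hmem'.toLp :=
    (hac.hasWeakDeriv (Weight.memL2loc hmem'.toLp) hae').congr hae .rfl
  have hx : WithLp.toLp 2 (φ 0, hmem.toLp) ∈ (opA w).domain :=
    ⟨⟨_, hweak⟩, φ, ⟨hmem.coeFn_toLp.symm, hac⟩, rfl⟩
  have hAx : (opA w ⟨_, hx⟩).snd = hmem'.toLp := hweak.weakDeriv_eq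
  exact ⟨⟨_, hx⟩, rfl, hae, hAx ▸ hae'⟩

theorem snd_eq_zero_of_mem_orthogonal_domain_opA {y : Hw w} (hy : y ∈ (opA w).domainᗮ) :
    y.snd = 0 := by
  have hloc : MemL2loc fun ξ => y.snd ξ * w ξ :=
    (Weight.memL2loc y.snd).mul_continuousOn w.continuousOn
  have hzero : (fun ξ => y.snd ξ * w ξ) =ᵐ[volume.restrict (Iic 0)] 0 := by
    refine hloc.ae_eq_zero_of_forall_integral_mul_eq_zero fun φ hφ => ?_
    obtain ⟨x, hx0, hx1, -⟩ := exists_mem_domain_opA w hφ.contDiff hφ.hasCompactSupport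
    have horth := hy x x.2
    rw [inner_Hw, hx0, hφ.eq_zero_of_nonneg le_rfl, zero_mul, zero_add,
      inner_L2w_eq_setIntegral hx1 .rfl] at horth
    simpa only [mul_comm] using horth
  rw [Lp.eq_zero_iff_ae_eq_zero, w.ae_measure]
  filter_upwards [hzero, ae_restrict_mem measurableSet_Iic] with ξ hξ hξ0
  exact (mul_eq_zero.1 hξ).resolve_right (w.ne_zero hξ0)

theorem fst_eq_zero_of_mem_orthogonal_domain_opA {y : Hw w} (hy : y ∈ (opA w).domainᗮ) :
    y.fst = 0 := by
  let B : ContDiffBump (0 : ℝ) := ⟨1, 2, one_pos, one_lt_two⟩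
  obtain ⟨x, hx0, -⟩ := exists_mem_domain_opA w B.contDiff B.hasCompactSupport
  have horth := hy x x.2
  rwa [inner_Hw, snd_eq_zero_of_mem_orthogonal_domain_opA hy, inner_zero_right, add_zero, hx0,
    B.one_of_mem_closedBall (Metric.mem_closedBall_self zero_le_one), one_mul] at horth

theorem dense_domain_opA (w : Weight) : Dense ((opA w).domain : Set (Hw w)) := by
  rw [Submodule.dense_iff_topologicalClosure_eq_top, Submodule.topologicalClosure_eq_top_iff,
    Submodule.eq_bot_iff]
  exact fun y hy => WithLp.ofLp_injective 2 (Prod.ext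
    (fst_eq_zero_of_mem_orthogonal_domain_opA hy) (snd_eq_zero_of_mem_orthogonal_domain_opA hy))

theorem hasWeakDeriv_snd_mul_weight {y z : Hw w}
    (h : ∀ x : (opA w).domain, inner ℝ (opA w x) y = inner ℝ (x : Hw w) z) :
    HasWeakDeriv (fun ξ => y.snd ξ * w ξ) (fun ξ => (-z.snd : L2w w) ξ * w ξ) := by
  refine ⟨(Weight.memL2loc _).mul_continuousOn w.continuousOn,
    (Weight.memL2loc _).mul_continuousOn w.continuousOn, fun φ hφ hc hs => ?_⟩
  obtain ⟨x, hx0, hx1, hx2⟩ := exists_mem_domain_opA w hφ hc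
  have hx := h x
  rw [inner_Hw, inner_Hw, opA_fst, hx0, IsTestFunction.eq_zero_of_nonneg ⟨hφ, hc, hs⟩ le_rfl,
    zero_mul, zero_mul, zero_add, zero_add, ← neg_inj, ← inner_neg_right (y := z.snd),
    inner_L2w_eq_setIntegral hx2 .rfl, inner_L2w_eq_setIntegral hx1 .rfl] at hx
  simpa only [mul_comm, neg_eq_iff_eq_neg] using hx

theorem hasWeakDeriv_snd {y z : Hw w}
    (h : ∀ x : (opA w).domain, inner ℝ (opA w x) y = inner ℝ (x : Hw w) z) :
    HasWeakDeriv y.snd (-z.snd - w.mulLogDeriv y.snd : L2w w) := by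
  have hsub := Lp.coeFn_sub (-z.snd) (w.mulLogDeriv y.snd)
  have hlog := w.coeFn_mulLogDeriv y.snd
  rw [w.ae_measure] at hsub hlog
  refine ((hasWeakDeriv_snd_mul_weight h).mul_contDiffOn w.contDiffOn_inv).congr ?_ ?_
  · filter_upwards [ae_restrict_mem measurableSet_Iic] with ξ hξ
    exact mul_inv_cancel_right₀ (w.ne_zero hξ) _
  · filter_upwards [hsub, hlog, ae_restrict_mem measurableSet_Iic] with ξ hsub hlog hξ
    have hinv : derivWithin (fun ξ => (w ξ)⁻¹) (Iic 0) ξ = -w.deriv ξ / w ξ ^ 2 :=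
      derivWithin_fun_inv' (w.contDiffOn.differentiableOn one_ne_zero ξ hξ) (w.ne_zero hξ)
    have hne := w.ne_zero hξ
    rw [hsub, Pi.sub_apply, hlog, hinv]
    field_simp
    ring

theorem adjoint_opA (w : Weight) : (opA w).adjoint = opAdjoint w := by
  have hdense := dense_domain_opA w
  have hle : opAdjoint w ≤ (opA w).adjoint := opA_isFormalAdjoint_opAdjoint.le_adjoint hdense
  refine (LinearPMap.eq_of_le_of_domain_eq hle (hle.1.antisymm fun y hy => ?_)).symm
  exact ⟨_, hasWeakDeriv_snd fun x =>
    (LinearPMap.adjoint_isFormalAdjoint hdense).symm x ⟨y, hy⟩⟩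

end WeightedDelay

theorem mainTheorem8 (w : Weight) :
    Dense ((opA w).domain : Set (Hw w)) ∧
    ((opA w).adjoint.domain : Set (Hw w)) = {x | x.snd ∈ W12 w} ∧
    ∀ (x : (opA w).adjoint.domain) (hx : (x : Hw w).snd ∈ W12 w),
      HasValueAtZero (x : Hw w).snd ((opA w).adjoint x).fst ∧
      ((opA w).adjoint x).snd =ᵐ[w.measure]
        fun ξ => - weakDeriv w ⟨(x : Hw w).snd, hx⟩ ξ - (x : Hw w).snd ξ * (w.deriv ξ / w ξ) := by
  rw [adjoint_opA]
  exact ⟨dense_domain_opA w, rfl, fun x hx =>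
    ⟨hasValueAtZero_valueAtZero ⟨(x : Hw w).snd, hx⟩, opAdjoint_snd_ae_eq x⟩⟩
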